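/- Let $\mathfrak{C}=\{0,1\}^{\mathbb{N}}$ be Cantor space, and let Thompson's group $V$ be the group of homeomorphisms $h$ of $\mathfrak{C}$ such that every $\kappa\in\mathfrak{C}$ has a finite prefix $w$ for which there is a finite word $u$ with $h(w\kappa')=u\kappa'$ for all $\kappa'\in\mathfrak{C}$. Let $G$ be a finitely generated subgroup of $V$, let $S$ be a finite symmetric generating set of $G$, let $\kappa_0\in\mathfrak{C}$, and let $X$ be the $G$-orbit of $\kappa_0$. Let $\Gamma$ be the action graph of $G$ on $X$ with respect to $S$, that is, the graph with vertex set $X$ and an edge from $x$ to $s(x)$ for all $x\in X$ and $s\in S$; under the canonical bijection between $X$ and the cosets of $\mathrm{Stab}_G(\kappa_0)$ in $G$, it is the Schreier graph of $G$ with respect to $\mathrm{Stab}_G(\kappa_0)$ and $S$. Then $\Gamma$ is connected and, with the path metric in which every edge has length $1$ (edge directions being ignored), $\Gamma$ is quasi-isometric to a tree. -/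

import Mathlib

/-- Cantor space `{0,1}^ℕ` of infinite binary sequences, with the product topology. -/
abbrev CantorSpace : Type := ℕ → Bool

/-- The infinite word `aκ`: the letter `a` followed by the infinite word `κ`. -/
def consLetter (a : Bool) (κ : CantorSpace) : CantorSpace
  | 0 => a
  | n + 1 => κ n

/-- The infinite word `wκ`: the finite word `w` followed by the infinite word `κ`. -/
def prependWord : List Bool → CantorSpace → CantorSpace
  | [], κ => κ
  | a :: w, κ => consLetter a (prependWord w κ)

theorem consLetter_inj {a b : Bool} {κ κ' : CantorSpace}
    (h : consLetter a κ = consLetter b κ') : a = b ∧ κ = κ' :=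
  ⟨congrFun h 0, funext fun n => congrFun h (n + 1)⟩

theorem prependWord_append (w t : List Bool) (κ : CantorSpace) :
    prependWord (w ++ t) κ = prependWord w (prependWord t κ) := by
  induction w with
  | nil => rfl
  | cons a w ih => simp [prependWord, ih]

/-- Of two prefixes of the same infinite word, one is a prefix of the other. -/
theorem prependWord_eq_prependWord {w w' : List Bool} {κ κ' : CantorSpace}
    (h : prependWord w κ = prependWord w' κ') :
    (∃ t, w' = w ++ t) ∨ (∃ t, w = w' ++ t) := by
  induction w generalizing w' with
  | nil => exact Or.inl ⟨w', rfl⟩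
  | cons a w ih =>
    cases w' with
    | nil => exact Or.inr ⟨a :: w, rfl⟩
    | cons b w' =>
      obtain ⟨rfl, h'⟩ := consLetter_inj h
      rcases ih h' with ⟨t, rfl⟩ | ⟨t, rfl⟩
      · exact Or.inl ⟨t, rfl⟩
      · exact Or.inr ⟨t, rfl⟩

/-- Thompson's group `V`: the homeomorphisms `h` of Cantor space such that every point `κ` has a
finite prefix `w` for which there is a finite word `u` with `h (wκ') = uκ'` for all `κ'`.
The product in `CantorSpace ≃ₜ CantorSpace` is composition of functions. -/
def thompsonV : Subgroup (CantorSpace ≃ₜ CantorSpace) where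
  carrier := {h | ∀ κ : CantorSpace, ∃ w u : List Bool,
    (∃ κ₁, κ = prependWord w κ₁) ∧ ∀ κ', h (prependWord w κ') = prependWord u κ'}
  one_mem' := fun κ => ⟨[], [], ⟨κ, rfl⟩, fun _ => rfl⟩
  mul_mem' := by
    intro f g hf hg κ
    obtain ⟨w, u, ⟨κ₁, rfl⟩, h₁⟩ := hg κ
    obtain ⟨w', u', ⟨κ₂, e⟩, h₂⟩ := hf (prependWord u κ₁)
    rcases prependWord_eq_prependWord e with ⟨t, rfl⟩ | ⟨t, rfl⟩
    · rw [prependWord_append] at e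
      have e' : κ₁ = prependWord t κ₂ := by
        have e₁ := (h₁ κ₁).trans (e.trans (h₁ (prependWord t κ₂)).symm)
        have e₂ := g.injective e₁
        clear h₁ e e₁ hf hg h₂
        induction w with
        | nil => exact e₂
        | cons a w ih => exact ih (consLetter_inj e₂).2
      refine ⟨w ++ t, u', ⟨κ₂, by rw [prependWord_append, ← e']⟩, fun κ' => ?_⟩
      rw [prependWord_append, Homeomorph.mul_apply, h₁, ← prependWord_append, h₂]
    · refine ⟨w, u' ++ t, ⟨κ₁, rfl⟩, fun κ' => ?_⟩
      rw [Homeomorph.mul_apply, h₁, prependWord_append, h₂, prependWord_append]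
  inv_mem' := by
    intro f hf κ
    obtain ⟨w, u, ⟨κ₁, e⟩, h⟩ := hf (f.symm κ)
    refine ⟨u, w, ⟨κ₁, by rw [← h, ← e, f.apply_symm_apply]⟩, fun κ' => ?_⟩
    rw [Homeomorph.inv_apply, ← h, f.symm_apply_apply]

/-- The defining action of `V` on Cantor space by evaluation, `h • κ = h κ`; subgroups of `V` act
by restriction. -/
instance thompsonVAction : MulAction thompsonV CantorSpace where
  smul h κ := h.1 κ
  one_smul _ := rfl
  mul_smul _ _ _ := rfl

/-- The action graph of a group `G` acting on a set `X`, with respect to a finite set `S` of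
elements of `G`: the directed graph with vertex set `X` and an edge from `x` to `s • x` for each
`x ∈ X` and `s ∈ S`. -/
def actionGraph {G : Type*} [Group G] (S : Finset G) (X : Type*) [MulAction G X] : Digraph X where
  Adj x y := ∃ s ∈ S, s • x = y

/-- The Schreier graph of `G` with respect to a subgroup `H` and a finite set `S`: the action graph
of `G` acting by translation on the cosets of `H`. -/
def schreierGraph {G : Type*} [Group G] (S : Finset G) (H : Subgroup G) : Digraph (G ⧸ H) :=
  actionGraph S (G ⧸ H)

/-- Two sets with distance functions are quasi-isometric if there is a map between them that
distorts distances by at most a multiplicative and an additive constant and whose image is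
coarsely dense. -/
def QuasiIsometric {X Y : Type*} (dX : X → X → ℝ) (dY : Y → Y → ℝ) : Prop :=
  ∃ (f : X → Y) (K C : ℝ), 1 ≤ K ∧ 0 ≤ C ∧
    (∀ x x', K⁻¹ * dX x x' - C ≤ dY (f x) (f x') ∧ dY (f x) (f x') ≤ K * dX x x' + C) ∧
    ∀ y, ∃ x, dY (f x) y ≤ C

/-- A graph, viewed as its vertex set with the path metric, is quasi-isometric to a tree
if it is connected (so that the path metric is defined) and its vertex set is quasi-isometric to
the vertex set of some tree. -/
def SimpleGraph.IsQuasiIsometricToTree {X : Type*} (Γ : SimpleGraph X) : Prop :=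
  Γ.Connected ∧ ∃ (Y : Type) (T : SimpleGraph Y), T.IsTree ∧
    QuasiIsometric (fun x x' => (Γ.dist x x' : ℝ)) (fun y y' => (T.dist y y' : ℝ))

/-! All points of the orbit share a tail with `κ₀`, so one can measure how many letters stand in
front of the common tail. This gives a level: a difference of prefix lengths if the tails of `κ₀`
are distinct, the preperiod if `κ₀` is eventually periodic. Let `R` bound the lengths of the
prefixes that generators replace. Level divided by `R` is a height changing by at most one along
edges, and the components of its superlevel sets form a tree.

The quotient map to this tree is a quasi-isometry once the bottom two layers of each component have
uniformly bounded diameter (`isQuasiIsometricToTree_of_height`). Along a path staying at least `R`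
above level `ℓ`, each point is `w t` with a fixed tail `t` of level `ℓ` and `w` of length at least
`R`, so generators only rewrite `w` (`TailLevel.exists_replace_prefix`). Near the bottom `w` has
length at most `3R`. Finitely many pairs of prefixes occur, each realised by one group element, and
a group element moves all vertices a bounded distance (`exists_dist_le_of_replace_prefix`). In the
eventually periodic case this breaks down near level zero, but there the sublevel sets are finite.
-/

/-! ### Height functions and the tree of superlevel components. -/

/-- A graph with an integer height that changes by one along each edge, and in which every vertex
has at most one lower neighbour, has no cycles. -/
theorem SimpleGraph.isAcyclic_of_height {Y : Type*} (T : SimpleGraph Y) (h : Y → ℤ)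
    (hstep : ∀ a b, T.Adj a b → h a = h b + 1 ∨ h b = h a + 1)
    (huniq : ∀ a b c, T.Adj a b → T.Adj a c → h a = h b + 1 → h a = h c + 1 → b = c) :
    T.IsAcyclic := by
  classical
  intro v c hc
  -- At a highest vertex of the cycle both cycle neighbours are lower, hence equal, which a cycle
  -- forbids.
  obtain ⟨u, hu, hmax⟩ := c.support.toFinset.exists_max_image h
    ⟨v, by simp⟩
  have hu' : u ∈ c.support := by simpa using hu
  have hcyc := hc.rotate hu'
  have hle : ∀ x ∈ (c.rotate u hu').support, h x ≤ h u := fun x hx =>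
    hmax x (by simpa using hx)
  have hnil := hcyc.not_nil
  have h₁ := (c.rotate u hu').adj_snd hnil
  have h₂ := ((c.rotate u hu').adj_penultimate hnil).symm
  have l₁ := hle (c.rotate u hu').snd ((c.rotate u hu').getVert_mem_support _)
  have l₂ := hle (c.rotate u hu').penultimate ((c.rotate u hu').getVert_mem_support _)
  refine hcyc.snd_ne_penultimate (huniq _ _ _ h₁ h₂ ?_ ?_)
  · rcases hstep _ _ h₁ with e | e <;> omega
  · rcases hstep _ _ h₂ with e | e <;> omega

namespace SimpleGraph

variable {X : Type*} (Γ : SimpleGraph X) (h : X → ℤ)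

/-- `x` and `y` are joined by a path in the subgraph of `Γ` of vertices of height at least `n`. -/
def JoinedAbove (n : ℤ) : X → X → Prop :=
  Relation.ReflTransGen fun a b => Γ.Adj a b ∧ n ≤ h a ∧ n ≤ h b

variable {Γ h}

theorem JoinedAbove.symm {n : ℤ} {x y : X} (hxy : Γ.JoinedAbove h n x y) :
    Γ.JoinedAbove h n y x :=
  have : Std.Symm fun a b => Γ.Adj a b ∧ n ≤ h a ∧ n ≤ h b :=
    ⟨fun _ _ hab => ⟨hab.1.symm, hab.2.2, hab.2.1⟩⟩
  Relation.ReflTransGen.stdSymm.symm _ _ hxy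

theorem JoinedAbove.trans {n : ℤ} {x y z : X} (hxy : Γ.JoinedAbove h n x y)
    (hyz : Γ.JoinedAbove h n y z) : Γ.JoinedAbove h n x z :=
  Relation.ReflTransGen.trans hxy hyz

theorem JoinedAbove.mono {m n : ℤ} (hmn : m ≤ n) {x y : X} (hxy : Γ.JoinedAbove h n x y) :
    Γ.JoinedAbove h m x y :=
  Relation.ReflTransGen.mono (fun _ _ hab => ⟨hab.1, hmn.trans hab.2.1, hmn.trans hab.2.2⟩) _ _ hxy

variable (Γ h)

/-- Two vertices of the same height are equivalent if they are joined by a path that does not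
go below that height. -/
def levelSetoid : Setoid X where
  r x y := h x = h y ∧ Γ.JoinedAbove h (h x) x y
  iseqv := ⟨fun _ => ⟨rfl, .refl⟩, fun hxy => ⟨hxy.1.symm, hxy.1 ▸ hxy.2.symm⟩,
    fun hxy hyz => ⟨hxy.1.trans hyz.1, hxy.2.trans (hxy.1 ▸ hyz.2)⟩⟩

/-- The tree of components of the superlevel sets of the height `h`. -/
def levelTree : SimpleGraph (Quotient (Γ.levelSetoid h)) where
  Adj p q := ∃ x y, Quotient.mk _ x = p ∧ Quotient.mk _ y = q ∧
    ((h y = h x + 1 ∧ Γ.JoinedAbove h (h x) x y) ∨ (h x = h y + 1 ∧ Γ.JoinedAbove h (h y) x y))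
  symm := ⟨fun _ _ ⟨x, y, hx, hy, e⟩ =>
    ⟨y, x, hy, hx, e.symm.imp (And.imp_right (·.symm)) (And.imp_right (·.symm))⟩⟩
  loopless := ⟨fun _ ⟨x, y, hx, hy, e⟩ => by
    have : h x = h y := (Quotient.exact (hx.trans hy.symm)).1
    rcases e with e | e <;> omega⟩

variable {Γ h}

/-- Two lower neighbours of a class are joined through that class without going below their own
height, so they coincide. -/
theorem levelTree_isAcyclic : (Γ.levelTree h).IsAcyclic := by
  refine isAcyclic_of_height _ (Quotient.lift h fun _ _ e => e.1) ?_ ?_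
  · rintro _ _ ⟨x, y, rfl, rfl, e | e⟩
    · exact Or.inr e.1
    · exact Or.inl e.1
  · rintro _ _ _ ⟨x, y, rfl, rfl, e⟩ ⟨x', z, hx', rfl, e'⟩ h₁ h₂
    have hxx := Quotient.exact hx'
    have exx : h x' = h x := hxx.1
    have jxx : Γ.JoinedAbove h (h x') x' x := hxx.2
    change h x = h y + 1 at h₁
    change h x = h z + 1 at h₂
    have e₁ : Γ.JoinedAbove h (h y) x y := by
      rcases e with e | e
      · omega
      · exact e.2
    have e₂ : Γ.JoinedAbove h (h z) x' z := by
      rcases e' with e | e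
      · omega
      · exact e.2
    have eyz : h y = h z := by omega
    refine Quotient.sound ⟨eyz, ?_⟩
    rw [← eyz] at e₂
    exact e₁.symm.trans (((jxx.mono (by omega)).symm).trans e₂)

theorem levelTree_mk_of_adj (hh : ∀ x y, Γ.Adj x y → |h x - h y| ≤ 1) {x y : X}
    (hxy : Γ.Adj x y) :
    (Quotient.mk (Γ.levelSetoid h) x) = Quotient.mk _ y ∨
      (Γ.levelTree h).Adj (Quotient.mk _ x) (Quotient.mk _ y) := by
  have := abs_le.1 (hh x y hxy)
  rcases lt_trichotomy (h x) (h y) with l | l | l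
  · exact Or.inr ⟨x, y, rfl, rfl, Or.inl ⟨by omega, .single ⟨hxy, le_rfl, l.le⟩⟩⟩
  · exact Or.inl (Quotient.sound ⟨l, .single ⟨hxy, le_rfl, l.le⟩⟩)
  · exact Or.inr ⟨x, y, rfl, rfl, Or.inr ⟨by omega, .single ⟨hxy, l.le, le_rfl⟩⟩⟩

theorem exists_levelTree_walk (hh : ∀ x y, Γ.Adj x y → |h x - h y| ≤ 1) {x y : X}
    (p : Γ.Walk x y) :
    ∃ q : (Γ.levelTree h).Walk (Quotient.mk _ x) (Quotient.mk _ y), q.length ≤ p.length := by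
  induction p with
  | nil => exact ⟨.nil, le_rfl⟩
  | cons hxy p ih =>
    obtain ⟨q, hq⟩ := ih
    rcases levelTree_mk_of_adj hh hxy with e | e
    · rw [e]
      exact ⟨q, by simp only [Walk.length_cons]; omega⟩
    · exact ⟨.cons e q, by simp only [Walk.length_cons]; omega⟩

/-- Each tree edge costs `D` to change representative and `D` to cross; the last `D` is the final
change of representative. -/
theorem dist_le_of_levelTree_walk (hc : Γ.Connected) {D : ℕ}
    (hD : ∀ n x y, Γ.JoinedAbove h n x y → n ≤ h x → h x ≤ n + 1 → h y ≤ n + 1 → Γ.dist x y ≤ D)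
    {P Q : Quotient (Γ.levelSetoid h)} (p : (Γ.levelTree h).Walk P Q) :
    ∀ x y, Quotient.mk _ x = P → Quotient.mk _ y = Q → Γ.dist x y ≤ 2 * D * p.length + D := by
  have same : ∀ x y, Quotient.mk (Γ.levelSetoid h) x = Quotient.mk _ y → Γ.dist x y ≤ D := by
    intro x y e
    obtain ⟨e₁, e₂⟩ := Quotient.exact e
    exact hD _ x y e₂ le_rfl (by omega) (by omega)
  induction p with
  | nil =>
    rintro x y rfl e
    simpa using same x y e.symm
  | cons hadj p ih =>
    intro x y ex ey
    obtain ⟨x', z, hx', hz, e⟩ := id hadj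
    have d₁ := same x x' (ex.trans hx'.symm)
    have d₂ : Γ.dist x' z ≤ D := by
      rcases e with e | e
      · exact hD _ x' z e.2 le_rfl (by omega) (by omega)
      · exact hD _ x' z e.2 (by omega) (by omega) (by omega)
    have d₃ := ih z y hz ey
    have t₁ := hc.dist_triangle (u := x) (v := x') (w := y)
    have t₂ := hc.dist_triangle (u := x') (v := z) (w := y)
    rw [Walk.length_cons, mul_add]
    omega

/-- A connected graph with a height function that changes by at most one along edges is
quasi-isometric to a tree if any two vertices in the bottom two layers of a component of a
superlevel set are at bounded distance. -/
theorem isQuasiIsometricToTree_of_height {X : Type} {Γ : SimpleGraph X} {h : X → ℤ}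
    (hc : Γ.Connected) (hh : ∀ x y, Γ.Adj x y → |h x - h y| ≤ 1) {D : ℕ}
    (hD : ∀ n x y, Γ.JoinedAbove h n x y → n ≤ h x → h x ≤ n + 1 → h y ≤ n + 1 →
      Γ.dist x y ≤ D) :
    Γ.IsQuasiIsometricToTree := by
  have hconn : (Γ.levelTree h).Connected := by
    have : Nonempty (Quotient (Γ.levelSetoid h)) := hc.nonempty.map (Quotient.mk _)
    refine ⟨fun P Q => ?_⟩
    induction P using Quotient.inductionOn with | _ x
    induction Q using Quotient.inductionOn with | _ y
    obtain ⟨p⟩ := hc.preconnected x y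
    exact ⟨(exists_levelTree_walk hh p).choose⟩
  -- The `+ 1` keeps the multiplicative constant at least one when `D = 0`.
  refine ⟨hc, _, Γ.levelTree h, ⟨hconn, levelTree_isAcyclic⟩, Quotient.mk _, 2 * D + 1, D,
    by linarith [Nat.cast_nonneg (α := ℝ) D], Nat.cast_nonneg _, fun x y => ⟨?_, ?_⟩, fun P => ?_⟩
  · obtain ⟨p, hp⟩ := hconn.exists_walk_length_eq_dist (Quotient.mk _ x) (Quotient.mk _ y)
    have key := dist_le_of_levelTree_walk hc hD p x y rfl rfl
    rw [hp] at key
    have key' : (Γ.dist x y : ℝ) ≤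
        2 * D * (Γ.levelTree h).dist (Quotient.mk _ x) (Quotient.mk _ y) + D := by
      exact_mod_cast key
    have hD0 : (0 : ℝ) ≤ D := Nat.cast_nonneg _
    have hT0 : (0 : ℝ) ≤ (Γ.levelTree h).dist (Quotient.mk _ x) (Quotient.mk _ y) :=
      Nat.cast_nonneg _
    rw [sub_le_iff_le_add, inv_mul_le_iff₀ (by linarith)]
    nlinarith
  · obtain ⟨p, hp⟩ := hc.exists_walk_length_eq_dist x y
    obtain ⟨q, hq⟩ := exists_levelTree_walk hh p
    have h₁ : ((Γ.levelTree h).dist (Quotient.mk _ x) (Quotient.mk _ y) : ℝ) ≤ Γ.dist x y := by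
      exact_mod_cast (dist_le q).trans (hq.trans hp.le)
    have hD0 : (0 : ℝ) ≤ D := Nat.cast_nonneg _
    have h0 : (0 : ℝ) ≤ Γ.dist x y := Nat.cast_nonneg _
    nlinarith
  · induction P using Quotient.inductionOn with | _ x
    exact ⟨x, by simp⟩

end SimpleGraph

/-! ### Tails, periodicity and preperiod of infinite words. -/

/-- The infinite word left after deleting the first `n` letters. -/
def dropLetters (n : ℕ) (κ : CantorSpace) : CantorSpace := fun i => κ (n + i)

theorem dropLetters_zero (κ : CantorSpace) : dropLetters 0 κ = κ := by
  funext i; simp [dropLetters]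

theorem dropLetters_dropLetters (m n : ℕ) (κ : CantorSpace) :
    dropLetters m (dropLetters n κ) = dropLetters (n + m) κ := by
  funext i; simp [dropLetters, Nat.add_assoc]

theorem dropLetters_succ_consLetter (n : ℕ) (a : Bool) (κ : CantorSpace) :
    dropLetters (n + 1) (consLetter a κ) = dropLetters n κ := by
  funext i
  change consLetter a κ (n + 1 + i) = κ (n + i)
  rw [Nat.add_right_comm]
  rfl

theorem dropLetters_prependWord (w : List Bool) (κ : CantorSpace) :
    dropLetters w.length (prependWord w κ) = κ := by
  induction w with
  | nil => exact dropLetters_zero κ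
  | cons a w ih => rw [List.length_cons, prependWord, dropLetters_succ_consLetter, ih]

theorem consLetter_dropLetters_one (κ : CantorSpace) :
    consLetter (κ 0) (dropLetters 1 κ) = κ := by
  funext i
  cases i with
  | zero => rfl
  | succ i => simp [consLetter, dropLetters, Nat.add_comm]

theorem exists_prependWord_dropLetters (n : ℕ) (κ : CantorSpace) :
    ∃ w : List Bool, w.length = n ∧ prependWord w (dropLetters n κ) = κ := by
  induction n generalizing κ with
  | zero => exact ⟨[], rfl, dropLetters_zero κ⟩
  | succ n ih =>
    obtain ⟨w, hw, e⟩ := ih (dropLetters 1 κ)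
    refine ⟨κ 0 :: w, by simp [hw], ?_⟩
    rw [dropLetters_dropLetters, Nat.add_comm] at e
    rw [prependWord, e, consLetter_dropLetters_one]

theorem prependWord_dropLetters_of_agree {w : List Bool} {κ κ' : CantorSpace}
    (h : ∀ i < w.length, κ' i = prependWord w κ i) :
    prependWord w (dropLetters w.length κ') = κ' := by
  induction w generalizing κ' with
  | nil => exact dropLetters_zero κ'
  | cons a w ih =>
    have h0 : κ' 0 = a := h 0 (by simp)
    have := ih (κ' := dropLetters 1 κ') fun i hi => by
      have := h (i + 1) (by simpa using hi)
      simpa [dropLetters, Nat.add_comm, prependWord, consLetter] using this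
    rw [dropLetters_dropLetters, Nat.add_comm] at this
    rw [prependWord, List.length_cons, this, ← h0, consLetter_dropLetters_one]

/-- `x` and `κ₀` agree after deletion of suitable finite prefixes. -/
def TailEquiv (κ₀ x : CantorSpace) : Prop := ∃ m n, dropLetters m x = dropLetters n κ₀

theorem TailEquiv.consLetter {κ₀ x : CantorSpace} (h : TailEquiv κ₀ x) (a : Bool) :
    TailEquiv κ₀ (consLetter a x) := by
  obtain ⟨m, n, e⟩ := h
  exact ⟨m + 1, n, by rw [dropLetters_succ_consLetter, e]⟩

theorem TailEquiv.dropLetters {κ₀ x : CantorSpace} (h : TailEquiv κ₀ x) (k : ℕ) :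
    TailEquiv κ₀ (dropLetters k x) := by
  obtain ⟨m, n, e⟩ := h
  refine ⟨m, n + k, ?_⟩
  rw [dropLetters_dropLetters, Nat.add_comm, ← dropLetters_dropLetters, e,
    dropLetters_dropLetters]

/-- A point fixed by the deletion of some positive number of letters. -/
def PeriodicWord (x : CantorSpace) : Prop := ∃ p, 0 < p ∧ dropLetters p x = x

theorem PeriodicWord.of_consLetter {a : Bool} {x : CantorSpace}
    (h : PeriodicWord (consLetter a x)) : PeriodicWord x := by
  obtain ⟨p, hp, e⟩ := h
  refine ⟨p, hp, ?_⟩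
  have := congrArg (dropLetters 1) e
  rwa [dropLetters_dropLetters, dropLetters_succ_consLetter, ← Nat.zero_add 1,
    dropLetters_succ_consLetter, dropLetters_zero] at this

theorem dropLetters_mul_period {p : ℕ} {x : CantorSpace} (h : dropLetters p x = x) (k : ℕ) :
    dropLetters (p * k) x = x := by
  induction k with
  | zero => exact dropLetters_zero x
  | succ k ih => rw [Nat.mul_succ, ← dropLetters_dropLetters, ih, h]

/-- The number of letters to delete to reach a periodic point. -/
noncomputable def preperiod (x : CantorSpace) : ℕ := sInf {n | PeriodicWord (dropLetters n x)}

theorem preperiod_eq_zero_of_periodicWord {x : CantorSpace} (h : PeriodicWord x) :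
    preperiod x = 0 :=
  Nat.sInf_eq_zero.2 (Or.inl (by simpa [dropLetters_zero] using h))

/-- The letter `a` must be deleted before a periodic point is reached. Without `hx` both preperiods
would be the default `sInf ∅ = 0`. -/
theorem preperiod_consLetter {x : CantorSpace} (hx : ∃ n, PeriodicWord (dropLetters n x))
    {a : Bool} (h : ¬ PeriodicWord (consLetter a x)) :
    preperiod (consLetter a x) = preperiod x + 1 := by
  have hmem : PeriodicWord (dropLetters (preperiod x) x) := Nat.sInf_mem hx
  have hmem' : PeriodicWord (dropLetters (preperiod (consLetter a x)) (consLetter a x)) :=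
    Nat.sInf_mem (s := {n | PeriodicWord (dropLetters n (consLetter a x))})
      ⟨preperiod x + 1, by simpa [dropLetters_succ_consLetter] using hmem⟩
  refine le_antisymm (Nat.sInf_le ?_) ?_
  · simpa [dropLetters_succ_consLetter] using hmem
  · rcases e : preperiod (consLetter a x) with _ | k
    · rw [e, dropLetters_zero] at hmem'
      exact absurd hmem' h
    · rw [e, dropLetters_succ_consLetter] at hmem'
      exact Nat.succ_le_succ (Nat.sInf_le hmem')

theorem finite_range_dropLetters {κ : CantorSpace} {a b : ℕ} (hab : a < b)
    (e : dropLetters a κ = dropLetters b κ) : (Set.range fun n => dropLetters n κ).Finite := by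
  refine ((Set.finite_Iio b).image fun n => dropLetters n κ).subset ?_
  rintro _ ⟨n, rfl⟩
  induction n using Nat.strong_induction_on with | _ n ih
  rcases lt_or_ge n b with h | h
  · exact ⟨n, h, rfl⟩
  · obtain ⟨k, rfl⟩ := Nat.exists_eq_add_of_le h
    have : dropLetters (b + k) κ = dropLetters (a + k) κ := by
      rw [← dropLetters_dropLetters, ← dropLetters_dropLetters, e]
    simp only [this]
    exact ih (a + k) (by omega)

/-! ### Levels on a tail equivalence class. -/

/-- A level on the tail equivalence class of `κ₀` that grows by one with every letter added in
front, except possibly at nonpositive levels outside an upper set `good`, in which case its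
sublevel sets are finite. -/
structure TailLevel (κ₀ : CantorSpace) where
  level : CantorSpace → ℤ
  good : ℤ → Prop
  good_mono : ∀ m n, m ≤ n → good m → good n
  nonpos_of_not_good : ∀ n, ¬ good n → n ≤ 0
  le_cons : ∀ a x, TailEquiv κ₀ x → level x ≤ level (consLetter a x)
  cons_le : ∀ a x, TailEquiv κ₀ x → level (consLetter a x) ≤ level x + 1
  cons_eq : ∀ a x, TailEquiv κ₀ x → good (level x) → level (consLetter a x) = level x + 1
  finite_le : ∀ n, ¬ good n → ∀ N, {x | TailEquiv κ₀ x ∧ level x ≤ N}.Finite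

theorem TailEquiv.prependWord {κ₀ x : CantorSpace} (h : TailEquiv κ₀ x) (w : List Bool) :
    TailEquiv κ₀ (prependWord w x) := by
  induction w with
  | nil => exact h
  | cons a w ih => exact ih.consLetter a

namespace TailLevel

variable {κ₀ : CantorSpace} (L : TailLevel κ₀)

theorem le_prependWord (w : List Bool) {x : CantorSpace} (hx : TailEquiv κ₀ x) :
    L.level x ≤ L.level (prependWord w x) := by
  induction w with
  | nil => exact le_rfl
  | cons a w ih => exact ih.trans (L.le_cons a _ (hx.prependWord w))

theorem prependWord_le (w : List Bool) {x : CantorSpace} (hx : TailEquiv κ₀ x) :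
    L.level (prependWord w x) ≤ L.level x + w.length := by
  induction w with
  | nil => simp [prependWord]
  | cons a w ih =>
    have := L.cons_le a _ (hx.prependWord w)
    simp only [prependWord, List.length_cons, Nat.cast_add, Nat.cast_one]
    omega

theorem prependWord_eq (w : List Bool) {x : CantorSpace} (hx : TailEquiv κ₀ x)
    (hg : L.good (L.level x)) : L.level (prependWord w x) = L.level x + w.length := by
  induction w with
  | nil => simp [prependWord]
  | cons a w ih =>
    have := L.cons_eq a _ (hx.prependWord w) (L.good_mono _ _ (L.le_prependWord w hx) hg)
    simp only [prependWord, List.length_cons, Nat.cast_add, Nat.cast_one]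
    omega

/-- The level of a point whose tails all differ: the difference of the lengths of the prefixes
before a common tail with the base point. -/
noncomputable def ofAperiodic (hinj : Function.Injective fun n => dropLetters n κ₀) :
    TailLevel κ₀ := by
  classical
  let lev : CantorSpace → ℤ := fun x =>
    if h : TailEquiv κ₀ x then (h.choose : ℤ) - h.choose_spec.choose else 0
  have key : ∀ x m n, dropLetters m x = dropLetters n κ₀ → lev x = (m : ℤ) - n := by
    intro x m n e
    have h : TailEquiv κ₀ x := ⟨m, n, e⟩
    have e' := h.choose_spec.choose_spec
    simp only [lev, dif_pos h]
    set m' := h.choose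
    set n' := h.choose_spec.choose
    -- Two descriptions of a common tail give the same tail of `κ₀`, so injectivity makes `m - n`
    -- independent of the choice.
    have e₁ : dropLetters (n + m') κ₀ = dropLetters (n' + m) κ₀ := by
      rw [← dropLetters_dropLetters, ← e, ← dropLetters_dropLetters, ← e',
        dropLetters_dropLetters, dropLetters_dropLetters, Nat.add_comm]
    have := hinj e₁
    omega
  have hcons : ∀ a x, TailEquiv κ₀ x → lev (consLetter a x) = lev x + 1 := by
    rintro a x ⟨m, n, e⟩
    rw [key x m n e, key (consLetter a x) (m + 1) n (by rw [dropLetters_succ_consLetter, e])]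
    push_cast
    ring
  exact
    { level := lev
      good := fun _ => True
      good_mono := fun _ _ _ h => h
      nonpos_of_not_good := fun _ h => absurd trivial h
      le_cons := fun a x hx => by rw [hcons a x hx]; omega
      cons_le := fun a x hx => (hcons a x hx).le
      cons_eq := fun a x hx _ => hcons a x hx
      finite_le := fun _ h => absurd trivial h }

/-- The level of a point of the tail class of an eventually periodic word: its preperiod. -/
noncomputable def ofPeriodic {a b : ℕ} (hab : a < b)
    (e : dropLetters a κ₀ = dropLetters b κ₀) : TailLevel κ₀ := by
  have hper : ∀ x, TailEquiv κ₀ x → ∃ n, PeriodicWord (dropLetters n x) := by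
    rintro x ⟨m, n, h⟩
    refine ⟨m + a, b - a, by omega, ?_⟩
    rw [← dropLetters_dropLetters, h, dropLetters_dropLetters, dropLetters_dropLetters,
      show n + (a + (b - a)) = b + n by omega, ← dropLetters_dropLetters, ← e,
      dropLetters_dropLetters, dropLetters_dropLetters, Nat.add_comm]
  exact
    { level := fun x => preperiod x
      -- Level zero consists of the periodic points, where adding a letter may give a periodic point
      -- again.
      good := fun n => 1 ≤ n
      good_mono := fun _ _ h h' => h'.trans h
      nonpos_of_not_good := fun _ h => by omega
      le_cons := fun c x hx => by
        by_cases h : PeriodicWord (consLetter c x)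
        · rw [preperiod_eq_zero_of_periodicWord h,
            preperiod_eq_zero_of_periodicWord h.of_consLetter]
        · rw [preperiod_consLetter (hper x hx) h]
          omega
      cons_le := fun c x hx => by
        by_cases h : PeriodicWord (consLetter c x)
        · rw [preperiod_eq_zero_of_periodicWord h]
          omega
        · rw [preperiod_consLetter (hper x hx) h]
          omega
      cons_eq := fun c x hx hg => by
        by_cases h : PeriodicWord (consLetter c x)
        · rw [preperiod_eq_zero_of_periodicWord h.of_consLetter] at hg
          omega
        · rw [preperiod_consLetter (hper x hx) h]
          push_cast
          rfl
      finite_le := fun _ _ N => by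
        -- A point of level at most `N` is a word of length at most `N` followed by one of the
        -- finitely many tails of `κ₀`.
        refine ((List.finite_length_le Bool N.toNat).image2 prependWord
          (finite_range_dropLetters hab e)).subset ?_
        rintro x ⟨hx, hN⟩
        obtain ⟨w, hw, ew⟩ := exists_prependWord_dropLetters (preperiod x) x
        refine ⟨w, ?_, _, ?_, ew⟩
        · simp only [Set.mem_ofPred_eq]
          omega
        · obtain ⟨p, hp, ep⟩ : PeriodicWord (dropLetters (preperiod x) x) := Nat.sInf_mem (hper x hx)
          obtain ⟨m, n, emn⟩ := hx.dropLetters (preperiod x)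
          -- After `m` deletions the periodic point agrees with a tail of `κ₀`; `p * m - m` more
          -- complete `m` periods and restore it.
          refine ⟨n + (p * m - m), ?_⟩
          simp only
          rw [← dropLetters_dropLetters, ← emn, dropLetters_dropLetters,
            Nat.add_sub_cancel' (Nat.le_mul_of_pos_left m hp), dropLetters_mul_period ep] }

theorem nonempty (κ₀ : CantorSpace) : Nonempty (TailLevel κ₀) := by
  by_cases hinj : Function.Injective fun n => dropLetters n κ₀
  · exact ⟨ofAperiodic hinj⟩
  · simp only [Function.Injective, not_forall] at hinj
    obtain ⟨a, b, e, hab⟩ := hinj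
    rcases lt_or_gt_of_ne hab with h | h
    · exact ⟨ofPeriodic h e⟩
    · exact ⟨ofPeriodic h e.symm⟩

end TailLevel

/-! ### Uniform bounds on replaced prefixes. -/

/-- By compactness, the prefixes which an element of `V` replaces may be taken of bounded
length. -/
theorem exists_prefix_bound (g : thompsonV) :
    ∃ R : ℕ, ∀ κ : CantorSpace, ∃ w u : List Bool, w.length ≤ R ∧ u.length ≤ R ∧
      (∃ κ₁, κ = prependWord w κ₁) ∧ ∀ κ', g • prependWord w κ' = prependWord u κ' := by
  suffices h : ∃ R : ℕ, ∀ κ ∈ (Set.univ : Set CantorSpace), ∃ w u : List Bool,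
      w.length ≤ R ∧ u.length ≤ R ∧ (∃ κ₁, κ = prependWord w κ₁) ∧
        ∀ κ', g • prependWord w κ' = prependWord u κ' by
    simpa using h
  refine isCompact_univ.induction_on (p := fun s : Set CantorSpace => ∃ R : ℕ, ∀ κ ∈ s,
    ∃ w u : List Bool, w.length ≤ R ∧ u.length ≤ R ∧ (∃ κ₁, κ = prependWord w κ₁) ∧
        ∀ κ', g • prependWord w κ' = prependWord u κ') ?_ ?_ ?_ ?_
  · exact ⟨0, by simp⟩
  · rintro s t hst ⟨R, hR⟩
    exact ⟨R, fun κ hκ => hR κ (hst hκ)⟩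
  · rintro s t ⟨R, hR⟩ ⟨R', hR'⟩
    refine ⟨max R R', ?_⟩
    rintro κ (hκ | hκ)
    · obtain ⟨w, u, hw, hu, h⟩ := hR κ hκ
      exact ⟨w, u, hw.trans (le_max_left _ _), hu.trans (le_max_left _ _), h⟩
    · obtain ⟨w, u, hw, hu, h⟩ := hR' κ hκ
      exact ⟨w, u, hw.trans (le_max_right _ _), hu.trans (le_max_right _ _), h⟩
  · intro κ _
    obtain ⟨w, u, ⟨κ₁, rfl⟩, h⟩ := g.2 κ
    refine ⟨{κ' | ∀ i ∈ Set.Iio w.length, κ' i = prependWord w κ₁ i}, mem_nhdsWithin_of_mem_nhds ?_,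
      max w.length u.length, fun κ' hκ' => ⟨w, u, le_max_left _ _, le_max_right _ _,
        ⟨_, (prependWord_dropLetters_of_agree hκ').symm⟩, h⟩⟩
    change ∀ᶠ κ' in nhds (prependWord w κ₁), ∀ i ∈ Set.Iio w.length, κ' i = prependWord w κ₁ i
    rw [Filter.eventually_all_finite (Set.finite_Iio _)]
    intro i _
    exact (continuous_apply i).continuousAt.eventually_mem
      ((isOpen_discrete {prependWord w κ₁ i}).mem_nhds rfl)

theorem exists_prependWord_of_length_ge {g : thompsonV} {R : ℕ}
    (hR : ∀ κ : CantorSpace, ∃ w u : List Bool, w.length ≤ R ∧ u.length ≤ R ∧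
      (∃ κ₁, κ = prependWord w κ₁) ∧ ∀ κ', g • prependWord w κ' = prependWord u κ')
    {v : List Bool} (hv : R ≤ v.length) :
    ∃ v', ∀ κ', g • prependWord v κ' = prependWord v' κ' := by
  -- The tail is arbitrary: the replaced prefix `w` is no longer than `v`, hence a prefix of `v`.
  obtain ⟨w, u, hw, -, ⟨κ₁, e⟩, h⟩ := hR (prependWord v fun _ => false)
  have : ∃ t, v = w ++ t := by
    rcases prependWord_eq_prependWord e with ⟨t, rfl⟩ | h
    · rw [List.length_append] at hw
      obtain rfl : t = [] := List.eq_nil_of_length_eq_zero (by omega)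
      exact ⟨[], by simp⟩
    · exact h
  obtain ⟨t, rfl⟩ := this
  exact ⟨u ++ t, fun κ' => by rw [prependWord_append, h, prependWord_append]⟩

/-! ### Displacement and connectedness in action graphs. -/

section ActionGraph

variable {G : Type*} [Group G] {S : Finset G} {X : Type*} [MulAction G X]

theorem actionGraph_adj_iff_of_equivariant {Y : Type*} [MulAction G Y] (e : X ≃ Y)
    (he : ∀ (g : G) x, e (g • x) = g • e x) (x y : X) :
    (actionGraph S X).Adj x y ↔ (actionGraph S Y).Adj (e x) (e y) := by
  simp only [actionGraph, ← he, e.apply_eq_iff_eq]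

theorem actionGraph_dist_smul_le_one {s : G} (hs : s ∈ S) (x : X) :
    (actionGraph S X).toSimpleGraphInclusive.Reachable x (s • x) ∧
      (actionGraph S X).toSimpleGraphInclusive.dist x (s • x) ≤ 1 := by
  by_cases h : x = s • x
  · rw [← h]
    exact ⟨.refl _, by simp⟩
  · have hadj : (actionGraph S X).toSimpleGraphInclusive.Adj x (s • x) :=
      ⟨h, Or.inl ⟨s, hs, rfl⟩⟩
    exact ⟨hadj.reachable, (SimpleGraph.dist_eq_one_iff_adj.2 hadj).le⟩

/-- Each group element moves the vertices of the action graph by a bounded distance. -/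
theorem exists_actionGraph_dist_smul_le (hgen : Subgroup.closure (S : Set G) = ⊤) (g : G) :
    ∃ D : ℕ, ∀ x : X, (actionGraph S X).toSimpleGraphInclusive.Reachable x (g • x) ∧
      (actionGraph S X).toSimpleGraphInclusive.dist x (g • x) ≤ D := by
  have hg : g ∈ Subgroup.closure (S : Set G) := hgen ▸ Subgroup.mem_top g
  induction hg using Subgroup.closure_induction with
  | mem s hs => exact ⟨1, fun x => actionGraph_dist_smul_le_one hs x⟩
  | one => exact ⟨0, fun x => by simp⟩
  | mul a b _ _ iha ihb =>
    obtain ⟨Da, ha⟩ := iha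
    obtain ⟨Db, hb⟩ := ihb
    refine ⟨Db + Da, fun x => ?_⟩
    rw [mul_smul]
    obtain ⟨r₁, d₁⟩ := hb x
    obtain ⟨r₂, d₂⟩ := ha (b • x)
    exact ⟨r₁.trans r₂, (r₁.dist_triangle_left _).trans (Nat.add_le_add d₁ d₂)⟩
  | inv a _ ih =>
    obtain ⟨D, h⟩ := ih
    refine ⟨D, fun x => ?_⟩
    obtain ⟨r, d⟩ := h (a⁻¹ • x)
    rw [smul_inv_smul] at r d
    exact ⟨r.symm, by rwa [SimpleGraph.dist_comm]⟩

theorem actionGraph_connected [MulAction.IsPretransitive G X] [Nonempty X]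
    (hgen : Subgroup.closure (S : Set G) = ⊤) :
    (actionGraph S X).toSimpleGraphInclusive.Connected := by
  refine ⟨fun x y => ?_⟩
  obtain ⟨g, rfl⟩ := MulAction.exists_smul_eq G x y
  exact ((exists_actionGraph_dist_smul_le hgen g).choose_spec x).1

theorem exists_smul_eq_of_actionGraph_adj (hsymm : ∀ s ∈ S, s⁻¹ ∈ S) {x y : X}
    (h : (actionGraph S X).toSimpleGraphInclusive.Adj x y) : ∃ s ∈ S, s • x = y := by
  rcases h.2 with h | ⟨s, hs, rfl⟩
  · exact h
  · exact ⟨s⁻¹, hsymm s hs, inv_smul_smul s y⟩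

end ActionGraph

theorem exists_uniform_prefix_bound {G : Subgroup thompsonV} (S : Finset G) :
    ∃ R : ℕ, 0 < R ∧ ∀ s ∈ S, ∀ κ : CantorSpace, ∃ w u : List Bool,
      w.length ≤ R ∧ u.length ≤ R ∧ (∃ κ₁, κ = prependWord w κ₁) ∧
        ∀ κ', s.1 • prependWord w κ' = prependWord u κ' := by
  choose R hR using exists_prefix_bound
  refine ⟨S.sup (fun s => R s) + 1, Nat.succ_pos _, fun s hs κ => ?_⟩
  have hle : R s ≤ S.sup (fun s => R s) + 1 :=
    (Finset.le_sup (f := fun s : G => R s) hs).trans (Nat.le_succ _)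
  obtain ⟨w, u, hw, hu, h⟩ := hR s κ
  exact ⟨w, u, hw.trans hle, hu.trans hle, h⟩

theorem tailEquiv_of_mem_orbit {G : Subgroup thompsonV} {κ₀ x : CantorSpace}
    (hx : x ∈ MulAction.orbit G κ₀) : TailEquiv κ₀ x := by
  obtain ⟨g, rfl⟩ := hx
  obtain ⟨w, u, ⟨κ₁, rfl⟩, h⟩ := g.1.2 κ₀
  refine ⟨u.length, w.length, ?_⟩
  change dropLetters u.length (g.1.1 (prependWord w κ₁)) = _
  rw [h, dropLetters_prependWord, dropLetters_prependWord]

/-! ### The orbit graph and its bottom layers. -/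

section Orbit

variable {G : Subgroup thompsonV} {S : Finset G} {κ₀ : CantorSpace}

variable (S κ₀) in
/-- The undirected action graph of `G` on the orbit of `κ₀`. -/
abbrev orbitGraph : SimpleGraph (MulAction.orbit G κ₀) :=
  (actionGraph S (MulAction.orbit G κ₀)).toSimpleGraphInclusive

/-- There are finitely many pairs of short words. For each, one chosen group element carries `x` to
`y` whatever the tail `t`, so its displacement bound serves for all tails. -/
theorem exists_dist_le_of_replace_prefix (hgen : Subgroup.closure (S : Set G) = ⊤) (N : ℕ) :
    ∃ D : ℕ, ∀ w w' : List Bool, w.length ≤ N → w'.length ≤ N →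
      (∃ g : G, ∀ t, g • prependWord w t = prependWord w' t) →
      ∀ (t : CantorSpace) (x y : MulAction.orbit G κ₀), x.1 = prependWord w t →
        y.1 = prependWord w' t → (orbitGraph S κ₀).dist x y ≤ D := by
  classical
  choose D hD using fun g : G =>
    exists_actionGraph_dist_smul_le (X := MulAction.orbit G κ₀) hgen g
  let f : List Bool × List Bool → ℕ := fun p =>
    if h : ∃ g : G, ∀ t, g • prependWord p.1 t = prependWord p.2 t then D h.choose else 0
  have hfin := List.finite_length_le Bool N
  obtain ⟨B, hB⟩ := ((hfin.prod hfin).image f).bddAbove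
  refine ⟨B, fun w w' hw hw' h t x y hx hy => ?_⟩
  have hle : f (w, w') ≤ B := hB ⟨(w, w'), ⟨hw, hw'⟩, rfl⟩
  simp only [f, dif_pos h] at hle
  have e : y = h.choose • x := Subtype.ext (by
    rw [hy, MulAction.orbit.coe_smul, hx, h.choose_spec])
  rw [e]
  exact ((hD _ x).2).trans hle

/-- Both endpoints are a prefix of length at most `R` followed by the same `κ₁`, so both levels lie
within `R` above that of `κ₁`. -/
theorem TailLevel.abs_sub_le_of_adj (L : TailLevel κ₀) {R : ℕ}
    (hR : ∀ s ∈ S, ∀ κ : CantorSpace, ∃ w u : List Bool,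
      w.length ≤ R ∧ u.length ≤ R ∧ (∃ κ₁, κ = prependWord w κ₁) ∧
        ∀ κ', s.1 • prependWord w κ' = prependWord u κ')
    (hsymm : ∀ s ∈ S, s⁻¹ ∈ S) {x y : MulAction.orbit G κ₀} (h : (orbitGraph S κ₀).Adj x y) :
    |L.level x - L.level y| ≤ R := by
  obtain ⟨s, hs, rfl⟩ := exists_smul_eq_of_actionGraph_adj hsymm h
  obtain ⟨w, u, hw, hu, ⟨κ₁, e⟩, hwu⟩ := hR s hs x
  have e' : (s • x).1 = prependWord u κ₁ := by
    rw [MulAction.orbit.coe_smul, e]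
    exact hwu κ₁
  have ht : TailEquiv κ₀ κ₁ := by
    have := (tailEquiv_of_mem_orbit x.2).dropLetters w.length
    rwa [e, dropLetters_prependWord] at this
  rw [e, e', abs_le]
  have := L.le_prependWord w ht
  have := L.prependWord_le w ht
  have := L.le_prependWord u ht
  have := L.prependWord_le u ht
  omega

/-- A path which stays above a level acts on the prefixes above that level independently of the
tail below it. -/
theorem TailLevel.exists_replace_prefix (L : TailLevel κ₀) {R : ℕ}
    (hR : ∀ s ∈ S, ∀ κ : CantorSpace, ∃ w u : List Bool,
      w.length ≤ R ∧ u.length ≤ R ∧ (∃ κ₁, κ = prependWord w κ₁) ∧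
        ∀ κ', s.1 • prependWord w κ' = prependWord u κ')
    (hsymm : ∀ s ∈ S, s⁻¹ ∈ S) {ℓ : ℤ} (hg : L.good ℓ) {x y : MulAction.orbit G κ₀}
    (hx : ℓ + R ≤ L.level x)
    (hxy : Relation.ReflTransGen (fun a b => (orbitGraph S κ₀).Adj a b ∧ ℓ + R ≤ L.level b) x y) :
    ∃ (t : CantorSpace) (w w' : List Bool), x.1 = prependWord w t ∧ y.1 = prependWord w' t ∧
      L.level x = ℓ + w.length ∧ L.level y = ℓ + w'.length ∧
        ∃ g : G, ∀ κ, g • prependWord w κ = prependWord w' κ := by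
  obtain ⟨k, hk⟩ := Int.eq_ofNat_of_zero_le (a := L.level x - ℓ) (by omega)
  obtain ⟨w, rfl, ew⟩ := exists_prependWord_dropLetters k x.1
  have ht : TailEquiv κ₀ (dropLetters w.length x.1) :=
    (tailEquiv_of_mem_orbit x.2).dropLetters _
  set t := dropLetters w.length x.1
  -- Deleting `level x - ℓ` letters lowers the level by at most that much, so `t` has good level;
  -- then the count is exact and `t` has level `ℓ`.
  have hle := L.prependWord_le w ht
  rw [ew] at hle
  have hgt : L.good (L.level t) := L.good_mono _ _ (by omega) hg
  have heq := L.prependWord_eq w ht hgt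
  rw [ew] at heq
  have htℓ : L.level t = ℓ := by omega
  refine ⟨t, w, ?_⟩
  suffices h : ∃ w' : List Bool, y.1 = prependWord w' t ∧ ℓ + R ≤ L.level y ∧
      ∃ g : G, ∀ κ, g • prependWord w κ = prependWord w' κ by
    obtain ⟨w', e, -, h⟩ := h
    exact ⟨w', ew.symm, e, by omega, by rw [e, L.prependWord_eq w' ht hgt, htℓ], h⟩
  induction hxy with
  | refl => exact ⟨w, ew.symm, hx, 1, fun κ => one_smul _ _⟩
  | tail _ hyz ih =>
    obtain ⟨w', e, hy, g, hgw⟩ := ih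
    obtain ⟨hadj, hz⟩ := hyz
    obtain ⟨s, hs, rfl⟩ := exists_smul_eq_of_actionGraph_adj hsymm hadj
    -- Staying at level at least `ℓ + R` means that `w'` has length at least `R`, so `s` cannot
    -- reach into `t`.
    rw [e, L.prependWord_eq w' ht hgt, htℓ] at hy
    obtain ⟨w'', hw''⟩ := exists_prependWord_of_length_ge (hR s hs) (v := w') (by omega)
    refine ⟨w'', ?_, hz, s * g, fun κ => ?_⟩
    · rw [MulAction.orbit.coe_smul, e]
      exact hw'' t
    · rw [mul_smul, hgw]
      exact hw'' κ

theorem actionGraph_orbit_isQuasiIsometricToTree (hsymm : ∀ s ∈ S, s⁻¹ ∈ S)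
    (hgen : Subgroup.closure (S : Set G) = ⊤) : (orbitGraph S κ₀).IsQuasiIsometricToTree := by
  obtain ⟨L⟩ := TailLevel.nonempty κ₀
  obtain ⟨R, hR0, hR⟩ := exists_uniform_prefix_bound S
  have : Nonempty (MulAction.orbit G κ₀) := ⟨⟨κ₀, MulAction.mem_orbit_self κ₀⟩⟩
  have hc : (orbitGraph S κ₀).Connected := actionGraph_connected hgen
  have hRz : (0 : ℤ) < R := by exact_mod_cast hR0
  -- Layers `n` and `n + 1` lie below level `n * R + 2 * R`, which is `3 * R` above the base level
  -- `n * R - R` used below.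
  obtain ⟨D₁, hD₁⟩ := exists_dist_le_of_replace_prefix (κ₀ := κ₀) hgen (3 * R)
  have hbad : ∃ D₂ : ℕ, ∀ ℓ : ℤ, ¬ L.good ℓ → ∀ x y : MulAction.orbit G κ₀,
      L.level x ≤ ℓ + 3 * R → L.level y ≤ ℓ + 3 * R → (orbitGraph S κ₀).dist x y ≤ D₂ := by
    by_cases h : ∃ ℓ, ¬ L.good ℓ
    · obtain ⟨ℓ₀, hℓ₀⟩ := h
      -- Levels that are not good are nonpositive, so this one finite set serves for every such `ℓ`.
      have hfin : {x : MulAction.orbit G κ₀ | L.level x ≤ 3 * R}.Finite :=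
        ((L.finite_le ℓ₀ hℓ₀ (3 * R)).preimage Subtype.val_injective.injOn).subset
          fun x hx => ⟨tailEquiv_of_mem_orbit x.2, hx⟩
      obtain ⟨B, hB⟩ := ((hfin.prod hfin).image fun p => (orbitGraph S κ₀).dist p.1 p.2).bddAbove
      refine ⟨B, fun ℓ hℓ x y hx hy => hB ⟨(x, y), ⟨?_, ?_⟩, rfl⟩⟩ <;>
      · have := L.nonpos_of_not_good ℓ hℓ
        simp only [Set.mem_ofPred_eq]
        omega
    · exact ⟨0, fun ℓ hℓ => absurd ⟨ℓ, hℓ⟩ h⟩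
  obtain ⟨D₂, hD₂⟩ := hbad
  have hlow : ∀ (n a : ℤ), n ≤ a / R ↔ n * R ≤ a := fun n a => Int.le_ediv_iff_mul_le hRz
  have hup : ∀ (n a : ℤ), a / R ≤ n + 1 → a < n * R + 2 * R := fun n a h => by
    rw [← add_mul]
    exact (Int.ediv_lt_iff_lt_mul hRz).1 (by omega)
  refine SimpleGraph.isQuasiIsometricToTree_of_height (h := fun x => L.level x / (R : ℤ)) hc
    (fun x y hxy => ?_) (D := max D₁ D₂) fun n x y hj hnx hx hy => ?_
  · have habs := abs_le.1 (L.abs_sub_le_of_adj hR hsymm hxy)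
    have h₁ : L.level x / (R : ℤ) ≤ L.level y / (R : ℤ) + 1 := by
      rw [← Int.add_mul_ediv_right _ _ hRz.ne']
      exact Int.ediv_le_ediv hRz (by omega)
    have h₂ : L.level y / (R : ℤ) ≤ L.level x / (R : ℤ) + 1 := by
      rw [← Int.add_mul_ediv_right _ _ hRz.ne']
      exact Int.ediv_le_ediv hRz (by omega)
    rw [abs_le]
    omega
  · have hx' := hup _ _ hx
    have hy' := hup _ _ hy
    rw [hlow] at hnx
    -- The base lies `R` below layer `n`, leaving prefixes of length at least `R` along the whole
    -- path.
    by_cases hg : L.good (n * R - R)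
    · obtain ⟨t, w, w', ex, ey, lx, ly, hgw⟩ := L.exists_replace_prefix hR hsymm hg
        (x := x) (y := y) (by omega)
        (Relation.ReflTransGen.mono (fun a b hab => ⟨hab.1, by
          have := (hlow _ _).1 hab.2.2
          omega⟩) _ _ hj)
      exact (hD₁ w w' (by omega) (by omega) hgw t x y ex ey).trans (le_max_left _ _)
    · exact (hD₂ _ hg x y (by omega) (by omega)).trans (le_max_right _ _)

end Orbit

theorem theoremA (G : Subgroup thompsonV) (S : Finset G)
    (hsymm : ∀ s ∈ S, s⁻¹ ∈ S) (hgen : Subgroup.closure (S : Set G) = ⊤)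
    (κ₀ : CantorSpace) :
    (∀ x y : MulAction.orbit G κ₀,
      (actionGraph S (MulAction.orbit G κ₀)).Adj x y ↔
        (schreierGraph S (MulAction.stabilizer G κ₀)).Adj
          (MulAction.orbitEquivQuotientStabilizer G κ₀ x)
          (MulAction.orbitEquivQuotientStabilizer G κ₀ y)) ∧
    (actionGraph S (MulAction.orbit G κ₀)).toSimpleGraphInclusive.IsQuasiIsometricToTree := by
  refine ⟨actionGraph_adj_iff_of_equivariant _ fun g x => ?_,
    actionGraph_orbit_isQuasiIsometricToTree hsymm hgen⟩
  rw [← Equiv.eq_symm_apply]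
  obtain ⟨q, rfl⟩ := (MulAction.orbitEquivQuotientStabilizer G κ₀).symm.surjective x
  rw [Equiv.apply_symm_apply]
  induction q using QuotientGroup.induction_on with | _ a
  exact Subtype.ext (mul_smul g a κ₀).symm
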